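/- For an integer $n\ge 0$ let $\mathbb{P}_n$ be the complex vector space of polynomials $a_0+a_1x+\cdots+a_nx^n$ of degree at most $n$, with the norm $\|(a_0,\dots,a_n)\|_2$, and for $r,u\in\mathbb{P}_k$ with coefficients $r_i,u_i$ put $r\odot u=\sum_{i=0}^k r_iu_i$. A subset $\Pi$ of a finite-dimensional normed space $\mathcal{U}$ over $\mathbb{C}$ is a complex analytic manifold of codimension $c$ if there is a normed space $\mathcal{V}$ over $\mathbb{C}$ of dimension $\dim\mathcal{U}-c$ such that every point of $\Pi$ has an open neighborhood $\Sigma$ in $\mathcal{U}$ and a holomorphic map from $\Sigma\cap\Pi$ onto an open subset of $\mathcal{V}$ with a holomorphic inverse. (A map on a non-open set is holomorphic if it is the restriction of a holomorphic map on an open set.) Let $k\le\min\{m,n\}$ be nonnegative integers and let $$\mathcal{P}^k_{m,n}=\{(p,q)\in\mathbb{P}_m\times\mathbb{P}_n : \deg p=m,\ \deg q=n,\ \deg\gcd(p,q)=k\}.$$ (a) $\mathcal{P}^k_{m,n}$ is a complex analytic manifold in $\mathbb{P}_m\times\mathbb{P}_n$ of codimension $k=\dim(\mathbb{C}\times\mathbb{P}_m\times\mathbb{P}_n)-\dim(\mathbb{P}_k\times\mathbb{P}_{m-k}\times\mathbb{P}_{n-k})$.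 (b) Let $(\hat p,\hat q)\in\mathcal{P}^k_{m,n}$. There is a triple $(\hat u,\hat v,\hat w)\in\mathbb{P}_k\times\mathbb{P}_{m-k}\times\mathbb{P}_{n-k}$ such that $\hat u$ is a greatest common divisor of $\hat p$ and $\hat q$, $\hat u\hat v=\hat p$ and $\hat u\hat w=\hat q$. For every such triple, $r\odot\hat u\neq0$ for almost all $r\in\mathbb{P}_k$ (Lebesgue measure on coefficient vectors), and for every $r\in\mathbb{P}_k$ with $\beta:=r\odot\hat u\ne0$ there is an open neighborhood $\Omega$ of $(\hat u,\hat v,\hat w,\hat p,\hat q)$ in $\mathbb{P}_k\times\mathbb{P}_{m-k}\times\mathbb{P}_{n-k}\times\mathbb{P}_m\times\mathbb{P}_n$, all of whose points $(u,v,w,p,q)$ satisfy $\deg p=m$, $\deg q=n$, $\deg u=k$ and $\gcd(v,w)=1$, such that the map $$\psi:\Omega\to\mathbb{C}\times\mathbb{P}_m\times\mathbb{P}_n,\qquad \psi(u,v,w,p,q)=(r\odot u-\beta,\ uv-p,\ uw-q)$$ is holomorphic and has the following properties, where $\mathcal{U}=\mathbb{P}_m\times\mathbb{P}_n$, $\mathcal{V}=\mathbb{P}_k\times\mathbb{P}_{m-k}\times\mathbb{P}_{n-k}$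 and $\mathcal{W}=\mathbb{C}\times\mathbb{P}_m\times\mathbb{P}_n$, so that $\dim\mathcal{V}\le\dim\mathcal{W}\le\dim\mathcal{U}+\dim\mathcal{V}<\infty$: (i) $\psi(\hat u,\hat v,\hat w,\hat p,\hat q)=(0,0,0)$; (ii) at $(\hat u,\hat v,\hat w,\hat p,\hat q)$ the Jacobian of $\psi$ is surjective and its partial Jacobian with respect to $(u,v,w)$ is injective; (iii) if $(u,v,w,p,q)\in\Omega$ and $\psi(u,v,w,p,q)=(0,0,0)$, then $(p,q)\in\mathcal{P}^k_{m,n}$; (iv) for every open neighborhood $\Delta$ of $(\hat u,\hat v,\hat w)$ in $\mathcal{V}$ there is an open neighborhood $\Sigma$ of $(\hat p,\hat q)$ in $\mathcal{U}$ such that for every $(p,q)\in\Sigma\cap\mathcal{P}^k_{m,n}$ there is a unique $(u,v,w)\in\Delta$ with $(u,v,w,p,q)\in\Omega$ and $\psi(u,v,w,p,q)=(0,0,0)$. -/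

import Mathlib

open Polynomial Set MeasureTheory

noncomputable section

/-! ### Complex analytic manifolds in normed spaces -/

/-- `f` is holomorphic on the (not necessarily open) set `S`: on `S` it agrees with a map that is
holomorphic (complex analytic) on an open set containing `S`. -/
def HolomorphicOn {E F : Type} [NormedAddCommGroup E] [NormedSpace ℂ E]
    [NormedAddCommGroup F] [NormedSpace ℂ F] (f : E → F) (S : Set E) : Prop :=
  ∃ (O : Set E) (g : E → F), IsOpen O ∧ S ⊆ O ∧ AnalyticOnNhd ℂ g O ∧ EqOn f g S

/-- The subset `M` of the finite-dimensional normed space `U` is a complex analytic manifold of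
dimension `d`: there is a `d`-dimensional normed space `V` such that every point of `M` has an open
neighbourhood `S` in `U` and a holomorphic map `φ` from `S ∩ M` onto an open subset `L` of `V` with
a holomorphic inverse `χ`. -/
def IsComplexManifoldOfDim {U : Type} [NormedAddCommGroup U] [NormedSpace ℂ U]
    [FiniteDimensional ℂ U] (M : Set U) (d : ℕ) : Prop :=
  ∃ (V : Type) (_ : NormedAddCommGroup V) (_ : NormedSpace ℂ V),
    FiniteDimensional ℂ V ∧ Module.finrank ℂ V = d ∧
    ∀ u ∈ M, ∃ (S : Set U) (L : Set V) (φ : U → V) (χ : V → U),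
      IsOpen S ∧ u ∈ S ∧ IsOpen L ∧
      HolomorphicOn φ (S ∩ M) ∧ φ '' (S ∩ M) = L ∧
      HolomorphicOn χ L ∧ MapsTo χ L (S ∩ M) ∧
      LeftInvOn χ φ (S ∩ M) ∧ RightInvOn χ φ L

/-- The subset `M` of `U` is a complex analytic manifold of codimension `c`. -/
def IsComplexManifoldOfCodim {U : Type} [NormedAddCommGroup U] [NormedSpace ℂ U]
    [FiniteDimensional ℂ U] (M : Set U) (c : ℕ) : Prop :=
  ∃ d : ℕ, IsComplexManifoldOfDim M d ∧ d + c = Module.finrank ℂ U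

/-- The equation `f (u, v) = 0`, to be solved for `v` at the data `u`, with `f` holomorphic on the
open domain `Ω ⊆ U × V`, is a geometric model of `M` at the data point `u₀` with solution `v₀`. -/
structure IsGeometricModelAt {U V W : Type} [NormedAddCommGroup U] [NormedSpace ℂ U]
    [NormedAddCommGroup V] [NormedSpace ℂ V] [NormedAddCommGroup W] [NormedSpace ℂ W]
    (M : Set U) (Ω : Set (U × V)) (f : U × V → W) (u₀ : U) (v₀ : V) : Prop where
  finite_data : FiniteDimensional ℂ U
  finite_var : FiniteDimensional ℂ V
  finite_target : FiniteDimensional ℂ W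
  dim_var_le : Module.finrank ℂ V ≤ Module.finrank ℂ W
  dim_target_le : Module.finrank ℂ W ≤ Module.finrank ℂ U + Module.finrank ℂ V
  isOpen_domain : IsOpen Ω
  mem_domain : (u₀, v₀) ∈ Ω
  holomorphic : AnalyticOnNhd ℂ f Ω
  zero_at : f (u₀, v₀) = 0
  jacobian_surjective : Function.Surjective (fderiv ℂ f (u₀, v₀))
  partial_jacobian_injective : Function.Injective (fderiv ℂ (fun v : V => f (u₀, v)) v₀)
  data_mem : ∀ u v, (u, v) ∈ Ω → f (u, v) = 0 → u ∈ M
  unique_solution : ∀ D : Set V, IsOpen D → v₀ ∈ D →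
    ∃ S : Set U, IsOpen S ∧ u₀ ∈ S ∧
      ∀ u ∈ S ∩ M, ∃! v : V, v ∈ D ∧ (u, v) ∈ Ω ∧ f (u, v) = 0

/-! ### Spaces of polynomials of bounded degree -/

/-- The space of complex polynomials of degree at most `n`. -/
abbrev PolyLE (n : ℕ) : Type := ↥(Polynomial.degreeLE ℂ (n : WithBot ℕ))

/-- The linear isomorphism that takes a polynomial of degree at most `n` to its vector of
coefficients `(a₀, …, aₙ)`. -/
def coeffEquiv (n : ℕ) : PolyLE n ≃ₗ[ℂ] EuclideanSpace ℂ (Fin (n + 1)) where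
  toFun p := WithLp.toLp 2 fun i => (p : ℂ[X]).coeff (i : ℕ)
  invFun a := ⟨∑ i : Fin (n + 1), monomial (i : ℕ) (a i),
    Submodule.sum_mem _ fun i _ => Polynomial.mem_degreeLE.2 <|
      (degree_monomial_le _ _).trans <| by exact_mod_cast Nat.lt_succ_iff.1 i.2⟩
  map_add' p q := by ext i; simp
  map_smul' c p := by ext i; simp
  left_inv p := by
    apply Subtype.ext
    have hp : (p : ℂ[X]).natDegree < n + 1 :=
      Nat.lt_succ_of_le (natDegree_le_of_degree_le (Polynomial.mem_degreeLE.1 p.2))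
    conv_rhs => rw [as_sum_range' (p : ℂ[X]) (n + 1) hp]
    simp [Finset.sum_range]
  right_inv a := by
    ext i
    simp [coeff_monomial, Fin.val_inj]

/-- The norm of a polynomial is the Euclidean norm of its coefficient vector. -/
instance PolyLE.instNormedAddCommGroup (n : ℕ) : NormedAddCommGroup (PolyLE n) :=
  NormedAddCommGroup.induced (PolyLE n) (EuclideanSpace ℂ (Fin (n + 1)))
    (coeffEquiv n) (coeffEquiv n).injective

instance PolyLE.instNormedSpace (n : ℕ) : NormedSpace ℂ (PolyLE n) :=
  NormedSpace.induced ℂ (PolyLE n) (EuclideanSpace ℂ (Fin (n + 1))) (coeffEquiv n)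

instance PolyLE.instFiniteDimensional (n : ℕ) : FiniteDimensional ℂ (PolyLE n) :=
  (coeffEquiv n).symm.finiteDimensional

/-- The product of a polynomial of degree at most `k` and one of degree at most `m - k`. -/
def mulLE {k m : ℕ} (h : k ≤ m) (u : PolyLE k) (v : PolyLE (m - k)) : PolyLE m :=
  ⟨(u : ℂ[X]) * (v : ℂ[X]), Polynomial.mem_degreeLE.2 <| by
    have hu := Polynomial.mem_degreeLE.1 u.2
    have hv := Polynomial.mem_degreeLE.1 v.2
    refine (degree_mul_le _ _).trans ((add_le_add hu hv).trans ?_)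
    exact_mod_cast (Nat.add_sub_of_le h).le⟩

/-- The (bilinear) dot product of the coefficient vectors of two polynomials. -/
def polyDot {k : ℕ} (r u : PolyLE k) : ℂ :=
  ∑ i ∈ Finset.range (k + 1), (r : ℂ[X]).coeff i * (u : ℂ[X]).coeff i

/-! ### Greatest common divisors -/

/-- The class of all greatest common divisors of `p` and `q` (they differ by nonzero constant
factors). -/
def gcdClass (p q : ℂ[X]) : Set ℂ[X] :=
  {g | g ∣ p ∧ g ∣ q ∧ ∀ d : ℂ[X], d ∣ p → d ∣ q → d ∣ g}

/-- The set of the pairs `(p, q)` of polynomials with `deg p = m`, `deg q = n` and greatest common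
divisor of degree `k`. -/
def gcdManifold (m n k : ℕ) : Set (PolyLE m × PolyLE n) :=
  {x | (x.1 : ℂ[X]).degree = m ∧ (x.2 : ℂ[X]).degree = n ∧
    ∃ g ∈ gcdClass (x.1 : ℂ[X]) (x.2 : ℂ[X]), g.degree = k}

/-- The triples `(u, v, w)` of a common factor of degree at most `k` and two cofactors. -/
abbrev GCDTriple (m n k : ℕ) : Type := PolyLE k × PolyLE (m - k) × PolyLE (n - k)

/-- The map `(u, v, w, p, q) ↦ (r ⊙ u - β, u v - p, u w - q)`, with the data `(p, q)` written first
and the unknowns `(u, v, w)` second. -/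
def gcdMap {m n k : ℕ} (hm : k ≤ m) (hn : k ≤ n) (r : PolyLE k) (β : ℂ)
    (x : (PolyLE m × PolyLE n) × GCDTriple m n k) : ℂ × PolyLE m × PolyLE n :=
  (polyDot r x.2.1 - β, mulLE hm x.2.1 x.2.2.1 - x.1.1, mulLE hn x.2.1 x.2.2.2 - x.1.2)

/-- `t = (u, v, w)` consists of a greatest common divisor `u` of `p` and `q` and of the cofactors
`v`, `w` with `u v = p` and `u w = q`, where `(p, q) = x`. -/
def IsGCDTriple {m n k : ℕ} (hm : k ≤ m) (hn : k ≤ n) (x : PolyLE m × PolyLE n)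
    (t : GCDTriple m n k) : Prop :=
  (t.1 : ℂ[X]) ∈ gcdClass (x.1 : ℂ[X]) (x.2 : ℂ[X]) ∧
    mulLE hm t.1 t.2.1 = x.1 ∧ mulLE hn t.1 t.2.2 = x.2

end

/-! ### Polynomials of bounded degree -/

/-! The pairs in the set are the products `(u v, u w)` with factors of full degree and `v`, `w`
coprime. The only freedom in the factorization is the scaling `(c u, c⁻¹ v, c⁻¹ w)`, since two
divisors of degree `k` with one dividing the other are proportional. Fixing `r ⊙ u` at a nonzero
value removes it (`IsGCDTriple.eq_of_polyDot_eq`), leaving a slice of dimension `m + n + 2 - k` on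
which the product map is injective.

The same holds infinitesimally: if `u v' + u' v = 0` and `u w' + u' w = 0`, a Bezout identity for
`v`, `w` gives `u ∣ u'`, so `u'` is a multiple of `u`, and `r ⊙ u' = 0` forces it to vanish
(`eq_zero_of_deriv_gcdProd_eq_zero`).

An injective immersion need not be open onto its image, so it remains to see that nearby pairs of
the set have nearby normalized triples (`IsGCDTriple.exists_isOpen_forall_exists`). This is
compactness: with `‖u‖ = 1`, the estimate `c ‖u‖ ‖v‖ ≤ ‖u v‖` bounds the cofactors. The inverse
function theorem then gives charts, and the same facts give the geometric model. Its domain is open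
because coprimality is expressed by surjectivity of a Bezout map. -/

theorem PolyLE.degree_le {n : ℕ} (p : PolyLE n) : (p : ℂ[X]).degree ≤ n :=
  Polynomial.mem_degreeLE.1 p.2

theorem PolyLE.degree_eq_iff {n : ℕ} (p : PolyLE n) :
    (p : ℂ[X]).degree = n ↔ (p : ℂ[X]).coeff n ≠ 0 :=
  ⟨coeff_ne_zero_of_eq_degree, degree_eq_of_le_of_coeff_ne_zero p.degree_le⟩

theorem PolyLE.finrank_eq (n : ℕ) : Module.finrank ℂ (PolyLE n) = n + 1 := by
  rw [(coeffEquiv n).finrank_eq, finrank_euclideanSpace_fin]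

/-- The `i`-th coefficient as a linear functional. -/
noncomputable def PolyLE.lcoeff (n i : ℕ) : PolyLE n →ₗ[ℂ] ℂ :=
  (Polynomial.lcoeff ℂ i).comp (Polynomial.degreeLE ℂ (n : WithBot ℕ)).subtype

theorem PolyLE.isOpen_degree_eq (n : ℕ) : IsOpen {p : PolyLE n | (p : ℂ[X]).degree = n} := by
  simp only [PolyLE.degree_eq_iff]
  exact isOpen_ne_fun (PolyLE.lcoeff n n).continuous_of_finiteDimensional continuous_const

/-- Multiplication as a bilinear map between spaces of polynomials of bounded degree. -/
noncomputable def PolyLE.mulBilin {a b c : ℕ} (h : a + b ≤ c) :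
    PolyLE a →ₗ[ℂ] PolyLE b →ₗ[ℂ] PolyLE c :=
  LinearMap.mk₂ ℂ
    (fun u v => ⟨(u : ℂ[X]) * (v : ℂ[X]), Polynomial.mem_degreeLE.2 <|
      (degree_mul_le _ _).trans ((add_le_add u.degree_le v.degree_le).trans (by exact_mod_cast h))⟩)
    (fun _ _ _ => Subtype.ext (add_mul _ _ _))
    (fun _ _ _ => Subtype.ext (smul_mul_assoc _ _ _))
    (fun _ _ _ => Subtype.ext (mul_add _ _ _))
    (fun _ _ _ => Subtype.ext (mul_smul_comm _ _ _))

theorem PolyLE.mulBilin_eq_zero {a b c : ℕ} {h : a + b ≤ c} {u : PolyLE a} {v : PolyLE b}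
    (huv : PolyLE.mulBilin h u v = 0) : u = 0 ∨ v = 0 := by
  have : (u : ℂ[X]) * (v : ℂ[X]) = 0 := congrArg Subtype.val huv
  simpa using this

@[simp]
theorem coe_mulLE {k m : ℕ} (h : k ≤ m) (u : PolyLE k) (v : PolyLE (m - k)) :
    (mulLE h u v : ℂ[X]) = u * v := rfl

theorem mulLE_eq_mulBilin {k m : ℕ} (h : k ≤ m) (u : PolyLE k) (v : PolyLE (m - k)) :
    mulLE h u v = (PolyLE.mulBilin (Nat.add_sub_of_le h).le).toContinuousBilinearMap u v := rfl

/-- The dot product with `r` as a linear functional. -/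
noncomputable def polyDotL {k : ℕ} (r : PolyLE k) : PolyLE k →ₗ[ℂ] ℂ where
  toFun := polyDot r
  map_add' u v := by simp [polyDot, mul_add, Finset.sum_add_distrib]
  map_smul' c u := by simp [polyDot, Finset.mul_sum, mul_left_comm]

@[simp]
theorem polyDotL_apply {k : ℕ} (r u : PolyLE k) : polyDotL r u = polyDot r u := rfl

theorem polyDot_smul {k : ℕ} (r u : PolyLE k) (c : ℂ) : polyDot r (c • u) = c * polyDot r u :=
  (polyDotL r).map_smul c u

theorem polyDot_comm {k : ℕ} (r u : PolyLE k) : polyDot r u = polyDot u r := by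
  simp [polyDot, mul_comm]

theorem exists_polyDot_ne_zero {k : ℕ} {u : PolyLE k} (hu : u ≠ 0) : ∃ r, polyDot r u ≠ 0 := by
  obtain ⟨i, hi⟩ : ∃ i, (u : ℂ[X]).coeff i ≠ 0 := by
    by_contra! h
    exact hu (Subtype.ext (Polynomial.ext (by simpa using h)))
  have hik : i ≤ k := by
    have := (le_degree_of_ne_zero hi).trans u.degree_le
    exact_mod_cast this
  refine ⟨⟨monomial i 1, Polynomial.mem_degreeLE.2 ((degree_monomial_le _ _).trans
    (by exact_mod_cast hik))⟩, ?_⟩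
  simpa [polyDot, coeff_monomial, Nat.lt_succ_of_le hik] using hi

theorem ae_polyDot_ne_zero {k : ℕ} {u : PolyLE k} (hu : u ≠ 0) :
    ∀ᵐ c : EuclideanSpace ℂ (Fin (k + 1)) ∂volume, polyDot ((coeffEquiv k).symm c) u ≠ 0 := by
  let f : EuclideanSpace ℂ (Fin (k + 1)) →ₗ[ℂ] ℂ :=
    (polyDotL u).comp (coeffEquiv k).symm.toLinearMap
  have hf : ∀ c, f c = polyDot ((coeffEquiv k).symm c) u := fun c => polyDot_comm _ _
  -- Haar measure vanishes on proper real subspaces, so the complex hyperplane is viewed over `ℝ`.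
  have hne : f.ker.restrictScalars ℝ ≠ ⊤ := by
    intro h
    obtain ⟨r, hr⟩ := exists_polyDot_ne_zero hu
    have : coeffEquiv k r ∈ f.ker.restrictScalars ℝ := h ▸ Submodule.mem_top
    rw [Submodule.restrictScalars_mem, LinearMap.mem_ker, hf] at this
    exact hr (by simpa using this)
  have := Measure.addHaar_submodule (volume : Measure (EuclideanSpace ℂ (Fin (k + 1)))) _ hne
  rw [ae_iff]
  convert this using 2
  ext c
  simp [← hf]

/-! ### Coprimality is an open condition -/

/-- If `R` is a right inverse of `T`, then `S ∘ R` is near the identity for `S` near `T`. Units of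
the complete algebra of endomorphisms of `F` form an open set, so `S ∘ R` is invertible and `S` is
onto. -/
theorem ContinuousLinearMap.isOpen_setOf_surjective {E F : Type*}
    [NormedAddCommGroup E] [NormedSpace ℂ E] [NormedAddCommGroup F] [NormedSpace ℂ F]
    [FiniteDimensional ℂ F] :
    IsOpen {T : E →L[ℂ] F | Function.Surjective T} := by
  have := FiniteDimensional.complete ℂ F
  rw [isOpen_iff_mem_nhds]
  intro T hT
  obtain ⟨R, hR⟩ := T.toLinearMap.exists_rightInverse_of_surjective (LinearMap.range_eq_top.2 hT)
  let R' : F →L[ℂ] E := R.toContinuousLinearMap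
  have hcont : Continuous fun S : E →L[ℂ] F => S.comp R' := by fun_prop
  have hunit : IsUnit (T.comp R') := by
    convert! isUnit_one
    ext y
    exact LinearMap.congr_fun hR y
  filter_upwards [hcont.continuousAt.preimage_mem_nhds (Units.isOpen.mem_nhds hunit)] with S hS y
  obtain ⟨V, hV⟩ := (show IsUnit (S.comp R') from hS).exists_right_inv
  exact ⟨R' (V y), DFunLike.congr_fun hV y⟩

/-- The Bezout map `(a, b) ↦ v a + w b`, as a linear function of `(v, w)`. -/
noncomputable def bezoutMap (s t : ℕ) :
    PolyLE s × PolyLE t →ₗ[ℂ] PolyLE t × PolyLE s →ₗ[ℂ] PolyLE (s + t) :=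
  ((PolyLE.mulBilin le_rfl).compl₁₂ (LinearMap.fst ℂ _ _) (LinearMap.fst ℂ _ _)) +
    ((PolyLE.mulBilin (add_comm t s).le).compl₁₂ (LinearMap.snd ℂ _ _) (LinearMap.snd ℂ _ _))

theorem coe_bezoutMap {s t : ℕ} (x : PolyLE s × PolyLE t) (y : PolyLE t × PolyLE s) :
    (bezoutMap s t x y : ℂ[X]) = x.1 * y.1 + x.2 * y.2 := rfl

theorem isCoprime_of_surjective_bezoutMap {s t : ℕ} {x : PolyLE s × PolyLE t}
    (h : Function.Surjective (bezoutMap s t x)) : IsCoprime (x.1 : ℂ[X]) (x.2 : ℂ[X]) := by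
  obtain ⟨y, hy⟩ := h ⟨1, Polynomial.mem_degreeLE.2
    (degree_one_le.trans (by exact_mod_cast Nat.zero_le _))⟩
  have := congrArg Subtype.val hy
  rw [coe_bezoutMap] at this
  exact ⟨y.1, y.2, by rw [mul_comm, mul_comm (y.2 : ℂ[X]), this]⟩

/-- A Bezout identity multiplied by `f` has coefficients of uncontrolled degree. Reducing the first
modulo `w` bounds it by `t`; since `w` has degree exactly `t`, comparing degrees in `w B = f - v A`
bounds the second by `s`. -/
theorem surjective_bezoutMap {s t : ℕ} {x : PolyLE s × PolyLE t}
    (hx : (x.2 : ℂ[X]).degree = t)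
    (h : IsCoprime (x.1 : ℂ[X]) (x.2 : ℂ[X])) : Function.Surjective (bezoutMap s t x) := by
  intro f
  obtain ⟨a, b, hab⟩ := h
  set v : ℂ[X] := (x.1 : ℂ[X])
  set w : ℂ[X] := (x.2 : ℂ[X])
  have hw0 : w ≠ 0 := by
    intro h0
    simp [h0] at hx
  set A : ℂ[X] := (f * a) % w
  set B : ℂ[X] := f * b + (f * a) / w * v
  have hAB : v * A + w * B = f := by
    have h1 : w * (f * a / w) + A = f * a := EuclideanDomain.div_add_mod _ _
    linear_combination v * h1 + (f : ℂ[X]) * hab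
  have hA : A.degree ≤ t := hx ▸ (EuclideanDomain.mod_lt (f * a) hw0).le
  have hB : B.degree ≤ s := by
    have hwB : (w * B).degree ≤ ((t + s : ℕ) : WithBot ℕ) := by
      rw [show w * B = f - v * A by rw [← hAB]; ring]
      refine (degree_sub_le _ _).trans (max_le ?_ ?_)
      · exact f.degree_le.trans (by exact_mod_cast (add_comm s t).le)
      · refine (degree_mul_le _ _).trans ((add_le_add x.1.degree_le hA).trans ?_)
        exact_mod_cast (add_comm s t).le
    rcases eq_or_ne B 0 with hB0 | hB0
    · simp [hB0]
    · rw [degree_mul, hx, degree_eq_natDegree hB0] at hwB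
      rw [degree_eq_natDegree hB0]
      norm_cast at hwB ⊢
      omega
  exact ⟨(⟨A, Polynomial.mem_degreeLE.2 hA⟩, ⟨B, Polynomial.mem_degreeLE.2 hB⟩), Subtype.ext hAB⟩

theorem isOpen_surjective_bezoutMap (s t : ℕ) :
    IsOpen {x : PolyLE s × PolyLE t | Function.Surjective (bezoutMap s t x)} :=
  (ContinuousLinearMap.isOpen_setOf_surjective
    (E := PolyLE t × PolyLE s) (F := PolyLE (s + t))).preimage
    (bezoutMap s t).toContinuousBilinearMap.continuous

/-! ### The map from triples to their products -/

/-- The map `(u, v, w) ↦ (u v, u w)`. -/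
noncomputable def gcdProd {m n k : ℕ} (hm : k ≤ m) (hn : k ≤ n) (t : GCDTriple m n k) :
    PolyLE m × PolyLE n :=
  (mulLE hm t.1 t.2.1, mulLE hn t.1 t.2.2)

section

variable {m n k : ℕ} {hm : k ≤ m} {hn : k ≤ n}

theorem gcdMap_eq (r : PolyLE k) (β : ℂ) (x : (PolyLE m × PolyLE n) × GCDTriple m n k) :
    gcdMap hm hn r β x = (polyDotL r x.2.1 - β, gcdProd hm hn x.2 - x.1) := rfl

theorem gcdMap_eq_zero_iff {r : PolyLE k} {β : ℂ} {x : PolyLE m × PolyLE n}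
    {t : GCDTriple m n k} :
    gcdMap hm hn r β (x, t) = 0 ↔ polyDot r t.1 = β ∧ gcdProd hm hn t = x := by
  rw [gcdMap_eq, Prod.mk_eq_zero, sub_eq_zero, sub_eq_zero, polyDotL_apply]

theorem analyticAt_gcdProd (t : GCDTriple m n k) : AnalyticAt ℂ (gcdProd hm hn) t := by
  unfold gcdProd
  simp only [mulLE_eq_mulBilin]
  have h1 : AnalyticAt ℂ (fun t : GCDTriple m n k => t.1) t := analyticAt_fst
  have h2 : AnalyticAt ℂ (fun t : GCDTriple m n k => t.2.1) t :=
    ((ContinuousLinearMap.fst ℂ (PolyLE (m - k)) (PolyLE (n - k))).comp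
      (ContinuousLinearMap.snd ℂ (PolyLE k) _)).analyticAt t
  have h3 : AnalyticAt ℂ (fun t : GCDTriple m n k => t.2.2) t :=
    ((ContinuousLinearMap.snd ℂ (PolyLE (m - k)) (PolyLE (n - k))).comp
      (ContinuousLinearMap.snd ℂ (PolyLE k) _)).analyticAt t
  exact ((ContinuousLinearMap.analyticAt_bilinear _ _).comp₂ h1 h2).prod
    ((ContinuousLinearMap.analyticAt_bilinear _ _).comp₂ h1 h3)

theorem continuous_gcdProd : Continuous (gcdProd (m := m) (n := n) hm hn) :=
  continuous_iff_continuousAt.2 fun t =>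
    (analyticAt_gcdProd (hm := hm) (hn := hn) t).continuousAt

theorem exists_hasFDerivAt_gcdProd (t : GCDTriple m n k) :
    ∃ D : GCDTriple m n k →L[ℂ] PolyLE m × PolyLE n, HasFDerivAt (gcdProd hm hn) D t ∧
      ∀ s, D s = (mulLE hm t.1 s.2.1 + mulLE hm s.1 t.2.1,
        mulLE hn t.1 s.2.2 + mulLE hn s.1 t.2.2) := by
  have h1 := (ContinuousLinearMap.fst ℂ (PolyLE k)
    (PolyLE (m - k) × PolyLE (n - k))).hasFDerivAt (x := t)
  have h2 := ((ContinuousLinearMap.fst ℂ (PolyLE (m - k)) (PolyLE (n - k))).comp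
    (ContinuousLinearMap.snd ℂ (PolyLE k) _)).hasFDerivAt (x := t)
  have h3 := ((ContinuousLinearMap.snd ℂ (PolyLE (m - k)) (PolyLE (n - k))).comp
    (ContinuousLinearMap.snd ℂ (PolyLE k) _)).hasFDerivAt (x := t)
  exact ⟨_, ((ContinuousLinearMap.hasFDerivAt_of_bilinear
    (PolyLE.mulBilin (Nat.add_sub_of_le hm).le).toContinuousBilinearMap h1 h2).prodMk
    (ContinuousLinearMap.hasFDerivAt_of_bilinear
    (PolyLE.mulBilin (Nat.add_sub_of_le hn).le).toContinuousBilinearMap h1 h3)), fun s => rfl⟩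

/-- The product map is unchanged when the common factor is scaled and the cofactors are scaled
inversely. -/
theorem gcdProd_smul {c d : ℂ} (hcd : c * d = 1) (t : GCDTriple m n k) :
    gcdProd hm hn (c • t.1, d • t.2) = gcdProd hm hn t := by
  refine Prod.ext (Subtype.ext ?_) (Subtype.ext ?_) <;>
  simp [gcdProd, smul_smul, hcd, mul_comm d c]

/-! ### Algebra of greatest common divisors -/

theorem degree_of_degree_mulLE {u : PolyLE k} {v : PolyLE (m - k)}
    (h : (mulLE hm u v : ℂ[X]).degree = m) :
    (u : ℂ[X]).degree = k ∧ (v : ℂ[X]).degree = (m - k : ℕ) := by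
  rw [coe_mulLE, degree_mul] at h
  have hu := u.degree_le
  have hv := v.degree_le
  have hu0 : (u : ℂ[X]) ≠ 0 := by
    intro h0
    simp [h0] at h
  have hv0 : (v : ℂ[X]) ≠ 0 := by
    intro h0
    simp [h0] at h
  rw [degree_eq_natDegree hu0] at *
  rw [degree_eq_natDegree hv0] at *
  norm_cast at *
  omega

theorem exists_mul_of_dvd {p : PolyLE m} {g : ℂ[X]} (hp : (p : ℂ[X]).degree = m)
    (hg : g.degree = k) (hgp : g ∣ p) : ∃ v : PolyLE (m - k), g * (v : ℂ[X]) = p := by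
  obtain ⟨v, hv⟩ := hgp
  refine ⟨⟨v, Polynomial.mem_degreeLE.2 ?_⟩, hv.symm⟩
  have hv0 : v ≠ 0 := by
    rintro rfl
    simp [hv] at hp
  rw [hv, degree_mul, hg, degree_eq_natDegree hv0] at hp
  rw [degree_eq_natDegree hv0]
  norm_cast at *
  omega

theorem isGCDTriple_iff {x : PolyLE m × PolyLE n} {t : GCDTriple m n k} :
    IsGCDTriple hm hn x t ↔
      (t.1 : ℂ[X]) ∈ gcdClass (x.1 : ℂ[X]) (x.2 : ℂ[X]) ∧ gcdProd hm hn t = x := by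
  rw [IsGCDTriple, Prod.ext_iff]
  rfl

theorem exists_isGCDTriple {x : PolyLE m × PolyLE n} (hx : x ∈ gcdManifold m n k) :
    ∃ t : GCDTriple m n k, IsGCDTriple hm hn x t := by
  obtain ⟨h1, h2, g, hg, hgk⟩ := hx
  obtain ⟨v, hv⟩ := exists_mul_of_dvd h1 hgk hg.1
  obtain ⟨w, hw⟩ := exists_mul_of_dvd h2 hgk hg.2.1
  exact ⟨(⟨g, Polynomial.mem_degreeLE.2 hgk.le⟩, v, w), hg, Subtype.ext hv, Subtype.ext hw⟩

theorem degree_of_gcdProd_mem {x : PolyLE m × PolyLE n} {t : GCDTriple m n k}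
    (hx : x ∈ gcdManifold m n k) (ht : gcdProd hm hn t = x) :
    (t.1 : ℂ[X]).degree = k ∧ (t.2.1 : ℂ[X]).degree = (m - k : ℕ) ∧
      (t.2.2 : ℂ[X]).degree = (n - k : ℕ) := by
  subst ht
  have h1 := degree_of_degree_mulLE (hm := hm) hx.1
  have h2 := degree_of_degree_mulLE (hm := hn) hx.2.1
  exact ⟨h1.1, h1.2, h2.2⟩

theorem ne_zero_of_degree_eq {u : PolyLE k} (hu : (u : ℂ[X]).degree = k) : u ≠ 0 := by
  rintro rfl
  simp at hu

/-- If `d` is the gcd of the cofactors, then `u d` is a common divisor of the pair, so it divides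
`u` and `d` is a unit. -/
theorem IsGCDTriple.isCoprime {x : PolyLE m × PolyLE n} {t : GCDTriple m n k}
    (hx : x ∈ gcdManifold m n k) (ht : IsGCDTriple hm hn x t) :
    IsCoprime (t.2.1 : ℂ[X]) (t.2.2 : ℂ[X]) := by
  rw [isGCDTriple_iff] at ht
  obtain ⟨hg, rfl⟩ := ht
  have hu : (t.1 : ℂ[X]) ≠ 0 := by
    simpa using ne_zero_of_degree_eq (degree_of_gcdProd_mem hx rfl).1
  refine (EuclideanDomain.gcd_isUnit_iff).1 ?_
  set d := EuclideanDomain.gcd (t.2.1 : ℂ[X]) (t.2.2 : ℂ[X])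
  have h := hg.2.2 (t.1 * d) (mul_dvd_mul_left _ (EuclideanDomain.gcd_dvd_left _ _))
    (mul_dvd_mul_left _ (EuclideanDomain.gcd_dvd_right _ _))
  rw [← mul_one (t.1 : ℂ[X]), mul_assoc, one_mul] at h
  exact isUnit_of_dvd_one ((mul_dvd_mul_iff_left hu).1 h)

theorem mem_gcdClass_of_isCoprime {u v w : ℂ[X]} (h : IsCoprime v w) :
    u ∈ gcdClass (u * v) (u * w) := by
  refine ⟨dvd_mul_right _ _, dvd_mul_right _ _, fun d h1 h2 => ?_⟩
  obtain ⟨a, b, hab⟩ := h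
  have : u = a * (u * v) + b * (u * w) := by linear_combination (-u) * hab
  rw [this]
  exact dvd_add (h1.mul_left _) (h2.mul_left _)

theorem gcdProd_mem {t : GCDTriple m n k} (hu : (t.1 : ℂ[X]).degree = k)
    (hv : (t.2.1 : ℂ[X]).degree = (m - k : ℕ)) (hw : (t.2.2 : ℂ[X]).degree = (n - k : ℕ))
    (hvw : IsCoprime (t.2.1 : ℂ[X]) (t.2.2 : ℂ[X])) :
    gcdProd hm hn t ∈ gcdManifold m n k := by
  refine ⟨?_, ?_, t.1, mem_gcdClass_of_isCoprime hvw, hu⟩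
  · simp only [gcdProd, coe_mulLE, degree_mul, hu, hv]
    exact_mod_cast Nat.add_sub_of_le hm
  · simp only [gcdProd, coe_mulLE, degree_mul, hu, hw]
    exact_mod_cast Nat.add_sub_of_le hn

theorem exists_smul_of_dvd {u u' : PolyLE k} (hu : (u : ℂ[X]).degree = k)
    (h : (u : ℂ[X]) ∣ u') : ∃ c : ℂ, u' = c • u := by
  obtain ⟨d, hd⟩ := h
  rcases eq_or_ne d 0 with rfl | hd0
  · exact ⟨0, Subtype.ext (by simpa using hd)⟩
  have h1 := u'.degree_le
  rw [hd, degree_mul, hu, degree_eq_natDegree hd0] at h1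
  have h2 : d.natDegree = 0 := by
    norm_cast at h1
    omega
  refine ⟨d.coeff 0, Subtype.ext ?_⟩
  rw [hd, eq_C_of_natDegree_eq_zero h2]
  simp [smul_eq_C_mul, mul_comm]

/-- Two factorizations of the same pair differ by a scalar, if one of them is a gcd triple. -/
theorem IsGCDTriple.eq_smul {x : PolyLE m × PolyLE n} {t t' : GCDTriple m n k}
    (hx : x ∈ gcdManifold m n k) (ht : IsGCDTriple hm hn x t) (ht' : gcdProd hm hn t' = x) :
    ∃ c : ℂ, t.1 = c • t'.1 ∧ t'.2 = c • t.2 := by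
  rw [isGCDTriple_iff] at ht
  have hu' := (degree_of_gcdProd_mem hx ht').1
  -- `t'.1` is a common divisor of full degree `k`, so it divides the gcd `t.1` with a constant
  -- quotient.
  have hdvd : (t'.1 : ℂ[X]) ∣ t.1 := by
    apply ht.1.2.2 <;> rw [← ht'] <;> exact dvd_mul_right _ _
  obtain ⟨c, hc⟩ := exists_smul_of_dvd hu' hdvd
  refine ⟨c, hc, ?_⟩
  have h0 : (t'.1 : ℂ[X]) ≠ 0 := by simpa using ne_zero_of_degree_eq hu'
  have h := ht'.trans ht.2.symm
  have h1 : (t'.1 : ℂ[X]) * t'.2.1 = t.1 * t.2.1 := congrArg (fun y => (y.1 : ℂ[X])) h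
  have h2 : (t'.1 : ℂ[X]) * t'.2.2 = t.1 * t.2.2 := congrArg (fun y => (y.2 : ℂ[X])) h
  rw [hc] at h1 h2
  refine Prod.ext (Subtype.ext (mul_left_cancel₀ h0 ?_)) (Subtype.ext (mul_left_cancel₀ h0 ?_))
  · simpa using h1
  · simpa using h2

theorem IsGCDTriple.eq_of_polyDot_eq {x : PolyLE m × PolyLE n} {t t' : GCDTriple m n k}
    (hx : x ∈ gcdManifold m n k) (ht : IsGCDTriple hm hn x t) (ht' : gcdProd hm hn t' = x)
    {r : PolyLE k} (h0 : polyDot r t.1 ≠ 0) (h : polyDot r t'.1 = polyDot r t.1) : t' = t := by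
  obtain ⟨c, h1, h2⟩ := ht.eq_smul hx ht'
  rw [h1, polyDot_smul] at h h0
  have hc : c = 1 := by
    have := right_ne_zero_of_mul h0
    exact mul_right_cancel₀ this (by rw [← h, one_mul])
  subst hc
  exact Prod.ext (by simpa using h1.symm) (by simpa using h2)

/-- The derivative of the product map is injective on the directions `s` with `r ⊙ s.1 = 0`. -/
theorem eq_zero_of_deriv_gcdProd_eq_zero {t s : GCDTriple m n k} (hu : (t.1 : ℂ[X]).degree = k)
    (hvw : IsCoprime (t.2.1 : ℂ[X]) (t.2.2 : ℂ[X])) {r : PolyLE k} (hr : polyDot r t.1 ≠ 0)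
    (hs : polyDot r s.1 = 0) (h1 : mulLE hm t.1 s.2.1 + mulLE hm s.1 t.2.1 = 0)
    (h2 : mulLE hn t.1 s.2.2 + mulLE hn s.1 t.2.2 = 0) : s = 0 := by
  have h0 : (t.1 : ℂ[X]) ≠ 0 := by simpa using ne_zero_of_degree_eq hu
  have e1 : (t.1 : ℂ[X]) * s.2.1 + s.1 * t.2.1 = 0 := congrArg Subtype.val h1
  have e2 : (t.1 : ℂ[X]) * s.2.2 + s.1 * t.2.2 = 0 := congrArg Subtype.val h2
  obtain ⟨a, b, hab⟩ := hvw
  -- By the Bezout identity, `a * e1 + b * e2` reads `u (a v' + b w') + u' = 0`.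
  have hdvd : (t.1 : ℂ[X]) ∣ s.1 :=
    ⟨-(a * s.2.1 + b * s.2.2), by linear_combination a * e1 + b * e2 - (s.1 : ℂ[X]) * hab⟩
  obtain ⟨c, hc⟩ := exists_smul_of_dvd hu hdvd
  have hs1 : s.1 = 0 := by
    rw [hc, polyDot_smul, mul_eq_zero, or_iff_left hr] at hs
    rw [hc, hs, zero_smul]
  simp only [hs1, ZeroMemClass.coe_zero, zero_mul, add_zero, mul_eq_zero, h0, false_or,
    ZeroMemClass.coe_eq_zero] at e1 e2
  exact Prod.ext hs1 (Prod.ext e1 e2)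

end

/-! ### Continuity of the factorization -/

/-- Without zero divisors, `‖B u v‖` is positive on the compact product of the unit spheres, hence
bounded below there by a positive constant; homogeneity does the rest. -/
theorem exists_pos_mul_norm_le_norm_bilinear {E F G : Type*}
    [NormedAddCommGroup E] [NormedSpace ℂ E] [FiniteDimensional ℂ E]
    [NormedAddCommGroup F] [NormedSpace ℂ F] [FiniteDimensional ℂ F]
    [NormedAddCommGroup G] [NormedSpace ℂ G] (B : E →L[ℂ] F →L[ℂ] G)
    (hB : ∀ u v, B u v = 0 → u = 0 ∨ v = 0) :
    ∃ c : ℝ, 0 < c ∧ ∀ u v, c * (‖u‖ * ‖v‖) ≤ ‖B u v‖ := by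
  have := FiniteDimensional.proper ℂ E
  have := FiniteDimensional.proper ℂ F
  have hK : IsCompact (Metric.sphere (0 : E) 1 ×ˢ Metric.sphere (0 : F) 1) :=
    (isCompact_sphere _ _).prod (isCompact_sphere _ _)
  have hcont : Continuous fun z : E × F => ‖B z.1 z.2‖ := by fun_prop
  obtain ⟨c, hc, hcK⟩ := hK.exists_forall_le' (a := 0) hcont.continuousOn (by
    rintro ⟨u, v⟩ ⟨hu, hv⟩
    rw [mem_sphere_zero_iff_norm] at hu hv
    refine norm_pos_iff.2 fun h => ?_
    rcases hB _ _ h with h | h <;> simp_all)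
  refine ⟨c, hc, fun u v => ?_⟩
  rcases eq_or_ne u 0 with rfl | hu
  · simp
  rcases eq_or_ne v 0 with rfl | hv
  · simp
  have h := hcK (((‖u‖⁻¹ : ℝ) : ℂ) • u, ((‖v‖⁻¹ : ℝ) : ℂ) • v) ⟨by
    simp [norm_smul, hu], by simp [norm_smul, hv]⟩
  have hu' := norm_pos_iff.2 hu
  have hv' := norm_pos_iff.2 hv
  simp only [map_smul, smul_apply, norm_smul, Complex.norm_real, norm_inv,
    norm_norm] at h
  rw [← mul_assoc, ← mul_inv, inv_mul_eq_div, le_div_iff₀ (by positivity)] at h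
  linarith [mul_comm ‖u‖ ‖v‖]

section

variable {m n k : ℕ} {hm : k ≤ m} {hn : k ≤ n}

theorem exists_pos_mul_norm_le_norm_mulLE {k m : ℕ} (h : k ≤ m) :
    ∃ c : ℝ, 0 < c ∧ ∀ (u : PolyLE k) (v : PolyLE (m - k)),
      c * (‖u‖ * ‖v‖) ≤ ‖mulLE h u v‖ :=
  exists_pos_mul_norm_le_norm_bilinear
    (PolyLE.mulBilin (Nat.add_sub_of_le h).le).toContinuousBilinearMap
    fun _ _ => PolyLE.mulBilin_eq_zero

/-- Triples with normalized first component that are mapped to a bounded set are bounded. -/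
theorem exists_norm_le_of_norm_gcdProd_le (C : ℝ) :
    ∃ R : ℝ, ∀ t : GCDTriple m n k, ‖t.1‖ = 1 → ‖gcdProd hm hn t‖ ≤ C → ‖t.2‖ ≤ R := by
  obtain ⟨c, hc, hc'⟩ := exists_pos_mul_norm_le_norm_mulLE hm
  obtain ⟨d, hd, hd'⟩ := exists_pos_mul_norm_le_norm_mulLE hn
  refine ⟨max (C / c) (C / d), fun t ht htC => ?_⟩
  have h1 := (hc' t.1 t.2.1).trans ((norm_fst_le (gcdProd hm hn t)).trans htC)
  have h2 := (hd' t.1 t.2.2).trans ((norm_snd_le (gcdProd hm hn t)).trans htC)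
  rw [ht, one_mul] at h1 h2
  exact max_le_max ((le_div_iff₀' hc).2 h1) ((le_div_iff₀' hd).2 h2)

/-- If `(p, q)` moves a little on the manifold, then so does its normalized gcd triple. -/
theorem IsGCDTriple.exists_isOpen_forall_exists {x : PolyLE m × PolyLE n} {t : GCDTriple m n k}
    (hx : x ∈ gcdManifold m n k) (ht : IsGCDTriple hm hn x t) {r : PolyLE k}
    (hr : polyDot r t.1 ≠ 0) {D : Set (GCDTriple m n k)} (hD : IsOpen D) (htD : t ∈ D) :
    ∃ S : Set (PolyLE m × PolyLE n), IsOpen S ∧ x ∈ S ∧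
      ∀ y ∈ S ∩ gcdManifold m n k, ∃ t' ∈ D,
        gcdProd hm hn t' = y ∧ polyDot r t'.1 = polyDot r t.1 := by
  have hprop : ∀ j, ProperSpace (PolyLE j) := fun j => FiniteDimensional.proper ℂ (PolyLE j)
  set β := polyDot r t.1 with hβ
  -- Rescaling to `r ⊙ u = β` without changing the products; it is meaningful and continuous only on
  -- `O`.
  let g : GCDTriple m n k → GCDTriple m n k := fun s =>
    ((β / polyDotL r s.1) • s.1, (polyDotL r s.1 / β) • s.2)
  have hl : Continuous fun s : GCDTriple m n k => polyDotL r s.1 :=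
    (polyDotL r).continuous_of_finiteDimensional.comp continuous_fst
  have hprod : ∀ s : GCDTriple m n k, polyDotL r s.1 ≠ 0 →
      gcdProd hm hn (g s) = gcdProd hm hn s := fun s hs =>
    gcdProd_smul (by field_simp) s
  have hdot : ∀ s : GCDTriple m n k, polyDotL r s.1 ≠ 0 → polyDot r (g s).1 = β := fun s hs => by
    rw [polyDot_smul, ← polyDotL_apply]
    field_simp
  let O : Set (GCDTriple m n k) := {s | polyDotL r s.1 ≠ 0}
  have hO : IsOpen O := isOpen_ne_fun hl continuous_const
  have hg : ContinuousOn g O := by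
    refine ContinuousOn.prodMk ?_ ?_
    · exact (continuousOn_const.div hl.continuousOn fun s hs => hs).smul continuous_fst.continuousOn
    · exact ((hl.div_const β).smul continuous_snd).continuousOn
  have hE : IsOpen (O ∩ g ⁻¹' D) := hg.isOpen_inter_preimage hO hD
  obtain ⟨R, hR⟩ := exists_norm_le_of_norm_gcdProd_le (hm := hm) (hn := hn) (‖x‖ + 1)
  let K : Set (GCDTriple m n k) := Metric.sphere 0 1 ×ˢ Metric.closedBall 0 R
  -- The bad triples of `K`, those not rescaled into `D`, have a compact, hence closed, image. Its
  -- complement near `x` is the required neighbourhood.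
  have hK : IsCompact (gcdProd hm hn '' (K \ (O ∩ g ⁻¹' D))) :=
    (((isCompact_sphere _ _).prod (isCompact_closedBall _ _)).diff hE).image continuous_gcdProd
  refine ⟨Metric.ball x 1 ∩ (gcdProd hm hn '' (K \ (O ∩ g ⁻¹' D)))ᶜ,
    Metric.isOpen_ball.inter hK.isClosed.isOpen_compl, ⟨Metric.mem_ball_self one_pos, ?_⟩, ?_⟩
  -- No bad triple lies over `x`: every factorization of `x` is a rescaling of `t`, so `g` sends it
  -- to `t`, which is in `D`.
  · rintro ⟨s, ⟨-, hs⟩, hsx⟩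
    obtain ⟨c, hc, -⟩ := ht.eq_smul hx hsx
    have hs0 : polyDotL r s.1 ≠ 0 := by
      intro h0
      rw [hc, polyDot_smul, ← polyDotL_apply, h0, mul_zero] at hβ
      exact hr hβ
    refine hs ⟨hs0, ?_⟩
    rw [mem_preimage, ht.eq_of_polyDot_eq hx ((hprod s hs0).trans hsx) hr (hdot s hs0)]
    exact htD
  · rintro y ⟨⟨hyx, hyK⟩, hy⟩
    obtain ⟨s, hs⟩ := exists_isGCDTriple (hm := hm) (hn := hn) hy
    have hsy := (isGCDTriple_iff.1 hs).2
    have hs0 : s.1 ≠ 0 := ne_zero_of_degree_eq (degree_of_gcdProd_mem hy hsy).1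
    have hn0 : (‖s.1‖ : ℂ) ≠ 0 := by simpa using hs0
    -- Scaling the gcd to norm one puts the triple in `K`; as `y` avoids the bad image, `g s'` lies
    -- in `D`.
    let s' : GCDTriple m n k := ((‖s.1‖ : ℂ)⁻¹ • s.1, (‖s.1‖ : ℂ) • s.2)
    have hs'y : gcdProd hm hn s' = y := (gcdProd_smul (inv_mul_cancel₀ hn0) s).trans hsy
    have hnorm : ‖s'.1‖ = 1 := by simp [s', norm_smul, hs0]
    have hs'K : s' ∈ K := by
      refine ⟨mem_sphere_zero_iff_norm.2 hnorm, mem_closedBall_zero_iff.2 (hR s' hnorm ?_)⟩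
      rw [hs'y]
      have := norm_le_norm_add_norm_sub x y
      rw [← dist_eq_norm, dist_comm] at this
      exact this.trans (add_le_add le_rfl (Metric.mem_ball.1 hyx).le)
    have hs'E : s' ∈ O ∩ g ⁻¹' D := by
      by_contra h
      exact hyK ⟨s', ⟨hs'K, h⟩, hs'y⟩
    exact ⟨g s', hs'E.2, (hprod s' hs'E.1).trans hs'y, hdot s' hs'E.1⟩

end

/-! ### Charts from parametrizations -/

/-- An analytic immersion that maps a neighbourhood of `a` homeomorphically onto a neighbourhood of
its image in `M` provides a chart. -/
theorem exists_chart_of_immersion {E U : Type} [NormedAddCommGroup E] [NormedSpace ℂ E]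
    [FiniteDimensional ℂ E] [NormedAddCommGroup U] [NormedSpace ℂ U] [FiniteDimensional ℂ U]
    {M : Set U} {G : E → U} {a : E} {G' : E →L[ℂ] U} (hG : ∀ e, AnalyticAt ℂ G e)
    (hG' : HasFDerivAt G G' a) (hinj : Function.Injective G')
    {N₀ : Set E} (hN₀ : IsOpen N₀) (haN₀ : a ∈ N₀) (hM : MapsTo G N₀ M)
    (hopen : ∀ D, IsOpen D → a ∈ D → ∃ S, IsOpen S ∧ G a ∈ S ∧ S ∩ M ⊆ G '' D) :
    ∃ (S : Set U) (L : Set E) (φ : U → E) (χ : E → U),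
      IsOpen S ∧ G a ∈ S ∧ IsOpen L ∧
      HolomorphicOn φ (S ∩ M) ∧ φ '' (S ∩ M) = L ∧
      HolomorphicOn χ L ∧ MapsTo χ L (S ∩ M) ∧
      LeftInvOn χ φ (S ∩ M) ∧ RightInvOn χ φ L := by
  have := FiniteDimensional.complete ℂ E
  -- With `P` a linear left inverse of `G'`, the map `P ∘ G` has derivative the identity at `a`. Its
  -- local inverse composed with `P` is holomorphic on an open set of the ambient space and inverts
  -- `G`.
  obtain ⟨P₀, hP₀⟩ := G'.toLinearMap.exists_leftInverse_of_injective (LinearMap.ker_eq_bot.2 hinj)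
  let P : U →L[ℂ] E := P₀.toContinuousLinearMap
  have hPG : P.comp G' = ((ContinuousLinearEquiv.refl ℂ E : E ≃L[ℂ] E) : E →L[ℂ] E) := by
    ext e
    exact LinearMap.congr_fun hP₀ e
  have han : AnalyticAt ℂ (P ∘ G) a := (P.analyticAt _).comp (hG a)
  have hder : HasFDerivAt (P ∘ G)
      ((ContinuousLinearEquiv.refl ℂ E : E ≃L[ℂ] E) : E →L[ℂ] E) a :=
    hPG ▸ P.hasFDerivAt.comp a hG'
  have hstrict : HasStrictFDerivAt (P ∘ G)
      ((ContinuousLinearEquiv.refl ℂ E : E ≃L[ℂ] E) : E →L[ℂ] E) a :=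
    hder.fderiv ▸ han.hasStrictFDerivAt
  let e := hstrict.toOpenPartialHomeomorph (P ∘ G)
  have ha : a ∈ e.source := hstrict.mem_toOpenPartialHomeomorph_source
  have hsymm : AnalyticAt ℂ e.symm (e a) :=
    e.analyticAt_symm' ha han hder.fderiv
  have hGc : Continuous G := continuous_iff_continuousAt.2 fun b => (hG b).continuousAt
  let T : Set E := {y | AnalyticAt ℂ e.symm y}
  have hT : IsOpen T := isOpen_analyticAt ℂ e.symm
  let N := N₀ ∩ e.source
  have hN : IsOpen N := hN₀.inter e.open_source
  obtain ⟨S₁, hS₁, haS₁, hS₁M⟩ := hopen N hN ⟨haN₀, ha⟩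
  have hφG : ∀ b ∈ N, e.symm (P (G b)) = b := fun b hb => e.left_inv hb.2
  have hS : IsOpen (S₁ ∩ P ⁻¹' T) := hS₁.inter (hT.preimage P.continuous)
  have hmaps : MapsTo G (N ∩ G ⁻¹' (S₁ ∩ P ⁻¹' T)) ((S₁ ∩ P ⁻¹' T) ∩ M) :=
    fun b hb => ⟨hb.2, hM hb.1.1⟩
  have hpar : ∀ y ∈ (S₁ ∩ P ⁻¹' T) ∩ M, ∃ b ∈ N ∩ G ⁻¹' (S₁ ∩ P ⁻¹' T), G b = y := by
    rintro y ⟨hyS, hyM⟩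
    obtain ⟨b, hb, rfl⟩ := hS₁M ⟨hyS.1, hyM⟩
    exact ⟨b, ⟨hb, hyS⟩, rfl⟩
  refine ⟨S₁ ∩ P ⁻¹' T, N ∩ G ⁻¹' (S₁ ∩ P ⁻¹' T), e.symm ∘ P, G, hS, ⟨haS₁, hsymm⟩,
    hN.inter (hS.preimage hGc), ?_, ?_, ?_, hmaps, ?_, ?_⟩
  · exact ⟨P ⁻¹' T, e.symm ∘ P, hT.preimage P.continuous, fun y hy => hy.1.2,
      fun y hy => AnalyticAt.comp hy (P.analyticAt y), fun _ _ => rfl⟩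
  · ext b
    constructor
    · rintro ⟨y, hy, rfl⟩
      obtain ⟨b, hb, rfl⟩ := hpar y hy
      simpa only [Function.comp_apply, hφG b hb.1] using hb
    · exact fun hb => ⟨G b, hmaps hb, hφG b hb.1⟩
  · exact ⟨univ, G, isOpen_univ, subset_univ _, fun b _ => hG b, fun _ _ => rfl⟩
  · intro y hy
    obtain ⟨b, hb, rfl⟩ := hpar y hy
    simp only [Function.comp_apply, hφG b hb.1]
  · exact fun b hb => hφG b hb.1

section

variable {m n k : ℕ} {hm : k ≤ m} {hn : k ≤ n}

/-! ### Regular triples -/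

/-- The triples of full degrees with coprime cofactors; coprimality is expressed by the surjectivity
of the Bezout map. -/
def regularTriples (m n k : ℕ) : Set (GCDTriple m n k) :=
  {s | ((s.1 : ℂ[X]).degree = k ∧ (s.2.1 : ℂ[X]).degree = (m - k : ℕ) ∧
    (s.2.2 : ℂ[X]).degree = (n - k : ℕ)) ∧ Function.Surjective (bezoutMap (m - k) (n - k) s.2)}

theorem isOpen_regularTriples : IsOpen (regularTriples m n k) := by
  have h1 : Continuous fun s : GCDTriple m n k => s.2.1 := by fun_prop
  have h2 : Continuous fun s : GCDTriple m n k => s.2.2 := by fun_prop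
  exact (((PolyLE.isOpen_degree_eq k).preimage continuous_fst).inter
    (((PolyLE.isOpen_degree_eq (m - k)).preimage h1).inter
      ((PolyLE.isOpen_degree_eq (n - k)).preimage h2))).inter
    ((isOpen_surjective_bezoutMap (m - k) (n - k)).preimage continuous_snd)

theorem isCoprime_of_mem_regularTriples {s : GCDTriple m n k} (hs : s ∈ regularTriples m n k) :
    IsCoprime (s.2.1 : ℂ[X]) (s.2.2 : ℂ[X]) :=
  isCoprime_of_surjective_bezoutMap hs.2

theorem gcdProd_mem_of_mem_regularTriples {s : GCDTriple m n k}
    (hs : s ∈ regularTriples m n k) : gcdProd hm hn s ∈ gcdManifold m n k :=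
  gcdProd_mem hs.1.1 hs.1.2.1 hs.1.2.2 (isCoprime_of_mem_regularTriples hs)

theorem IsGCDTriple.mem_regularTriples {x : PolyLE m × PolyLE n} {t : GCDTriple m n k}
    (hx : x ∈ gcdManifold m n k) (ht : IsGCDTriple hm hn x t) : t ∈ regularTriples m n k := by
  have hd := degree_of_gcdProd_mem hx (isGCDTriple_iff.1 ht).2
  exact ⟨hd, surjective_bezoutMap hd.2.2 (ht.isCoprime hx)⟩

/-! ### The manifold structure -/

theorem finrank_gcdTriple :
    Module.finrank ℂ (GCDTriple m n k) = (k + 1) + ((m - k + 1) + (n - k + 1)) := by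
  simp only [Module.finrank_prod, PolyLE.finrank_eq]

/-- A linear parametrization of the directions `s` with `r ⊙ s.1 = 0`. -/
theorem exists_parametrization_polyDot_eq_zero (hm : k ≤ m) (hn : k ≤ n) {r u : PolyLE k}
    (hr : polyDot r u ≠ 0) :
    ∃ ι : EuclideanSpace ℂ (Fin (m + n + 2 - k)) →L[ℂ] GCDTriple m n k,
      Function.Injective ι ∧ (∀ a, polyDot r (ι a).1 = 0) ∧
        ∀ s, polyDot r s.1 = 0 → ∃ a, ι a = s := by
  let l : GCDTriple m n k →ₗ[ℂ] ℂ := (polyDotL r).comp (LinearMap.fst ℂ _ _)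
  have hl : l.range = ⊤ := LinearMap.range_eq_top.2 (LinearMap.surjective fun h =>
    hr (LinearMap.congr_fun h (u, 0)))
  have hrank := l.finrank_range_add_finrank_ker
  rw [hl, finrank_top, Module.finrank_self, finrank_gcdTriple] at hrank
  -- The triples have dimension `m + n + 3 - k`, and the nonzero functional `l` cuts it by one.
  let e : EuclideanSpace ℂ (Fin (m + n + 2 - k)) ≃ₗ[ℂ] l.ker :=
    LinearEquiv.ofFinrankEq _ _ (by rw [finrank_euclideanSpace_fin]; omega)
  refine ⟨(l.ker.subtype.comp e.toLinearMap).toContinuousLinearMap,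
    l.ker.injective_subtype.comp e.injective, fun a => (e a).2, fun s hs => ?_⟩
  exact ⟨e.symm ⟨s, hs⟩, congrArg Subtype.val (e.apply_symm_apply _)⟩

theorem isComplexManifoldOfCodim_gcdManifold (hm : k ≤ m) (hn : k ≤ n) :
    IsComplexManifoldOfCodim (gcdManifold m n k) k := by
  refine ⟨m + n + 2 - k, ⟨EuclideanSpace ℂ (Fin (m + n + 2 - k)), inferInstance, inferInstance,
    inferInstance, finrank_euclideanSpace_fin, fun x hx => ?_⟩, ?_⟩
  · obtain ⟨t, ht⟩ := exists_isGCDTriple (hm := hm) (hn := hn) hx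
    have htx := (isGCDTriple_iff.1 ht).2
    have hreg := ht.mem_regularTriples hx
    obtain ⟨r, hr⟩ := exists_polyDot_ne_zero (ne_zero_of_degree_eq hreg.1.1)
    obtain ⟨ι, hι, hι0, hιs⟩ := exists_parametrization_polyDot_eq_zero hm hn hr
    -- The affine slice through `t` on which `r ⊙ u` keeps its value.
    let τ : EuclideanSpace ℂ (Fin (m + n + 2 - k)) → GCDTriple m n k := fun a => t + ι a
    have hτ0 : τ 0 = t := by simp [τ]
    have hτ : Continuous τ := continuous_const.add ι.continuous
    have hτ' : HasFDerivAt τ ι 0 := ι.hasFDerivAt.const_add t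
    obtain ⟨D, hD, hDs⟩ := exists_hasFDerivAt_gcdProd (hm := hm) (hn := hn) (τ 0)
    have hG0 : (gcdProd hm hn ∘ τ) 0 = x := by rw [Function.comp_apply, hτ0, htx]
    rw [← hG0]
    refine exists_chart_of_immersion (G' := D.comp ι) (N₀ := τ ⁻¹' regularTriples m n k)
      (fun a => (analyticAt_gcdProd (τ a)).comp (analyticAt_const.add (ι.analyticAt a)))
      (hD.comp 0 hτ') ?_ (isOpen_regularTriples.preimage hτ) (by rwa [mem_preimage, hτ0])
      (fun a ha => gcdProd_mem_of_mem_regularTriples ha) fun A hA h0A => ?_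
    · refine (injective_iff_map_eq_zero (D.comp ι)).2 fun a ha => ?_
      rw [ContinuousLinearMap.comp_apply, hDs, hτ0, Prod.mk_eq_zero] at ha
      exact (map_eq_zero_iff ι hι).1 (eq_zero_of_deriv_gcdProd_eq_zero hreg.1.1
        (isCoprime_of_mem_regularTriples hreg) hr (hι0 a) ha.1 ha.2)
    -- An injective linear map is an embedding, so open sets of parameters are traces of open sets
    -- of triples.
    · obtain ⟨B, hB, rfl⟩ := (LinearMap.isClosedEmbedding_of_injective (f := ι.toLinearMap)
        (LinearMap.ker_eq_bot.2 hι)).isInducing.isOpen_iff.1 hA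
      obtain ⟨S, hS, hxS, hSM⟩ := ht.exists_isOpen_forall_exists hx hr
        (D := (fun s => s - t) ⁻¹' B) (hB.preimage (by fun_prop)) (by simpa using h0A)
      refine ⟨S, hS, by rwa [hG0], fun y hy => ?_⟩
      obtain ⟨s, hsB, hsy, hsr⟩ := hSM y hy
      obtain ⟨a, ha⟩ := hιs (s - t) (by
        rw [← polyDotL_apply, Prod.fst_sub, map_sub, polyDotL_apply, polyDotL_apply, hsr, sub_self])
      refine ⟨a, ?_, ?_⟩
      · change ι a ∈ B
        rw [ha]
        exact hsB
      · simp only [Function.comp_apply, τ, ha, add_sub_cancel, hsy]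
  · rw [Module.finrank_prod, PolyLE.finrank_eq, PolyLE.finrank_eq]
    omega

/-! ### The geometric model -/

theorem analyticAt_gcdMap (r : PolyLE k) (β : ℂ)
    (y : (PolyLE m × PolyLE n) × GCDTriple m n k) : AnalyticAt ℂ (gcdMap hm hn r β) y := by
  have h1 : AnalyticAt ℂ (fun y : (PolyLE m × PolyLE n) × GCDTriple m n k => polyDotL r y.2.1) y :=
    ((polyDotL r).toContinuousLinearMap.comp ((ContinuousLinearMap.fst ℂ _ _).comp
      (ContinuousLinearMap.snd ℂ (PolyLE m × PolyLE n) (GCDTriple m n k)))).analyticAt y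
  have h2 : AnalyticAt ℂ
      (fun y : (PolyLE m × PolyLE n) × GCDTriple m n k => gcdProd hm hn y.2) y :=
    (analyticAt_gcdProd y.2).comp analyticAt_snd
  exact (h1.sub analyticAt_const).prod (h2.sub analyticAt_fst)

theorem exists_hasFDerivAt_gcdMap (r : PolyLE k) (β : ℂ)
    (y : (PolyLE m × PolyLE n) × GCDTriple m n k) :
    ∃ D : ((PolyLE m × PolyLE n) × GCDTriple m n k) →L[ℂ] ℂ × PolyLE m × PolyLE n,
      HasFDerivAt (gcdMap hm hn r β) D y ∧
      ∀ z, D z = (polyDot r z.2.1, (mulLE hm y.2.1 z.2.2.1 + mulLE hm z.2.1 y.2.2.1,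
        mulLE hn y.2.1 z.2.2.2 + mulLE hn z.2.1 y.2.2.2) - z.1) := by
  obtain ⟨D, hD, hDs⟩ := exists_hasFDerivAt_gcdProd (hm := hm) (hn := hn) y.2
  have h1 := ((polyDotL r).toContinuousLinearMap.comp ((ContinuousLinearMap.fst ℂ _ _).comp
      (ContinuousLinearMap.snd ℂ (PolyLE m × PolyLE n) (GCDTriple m n k)))).hasFDerivAt (x := y)
  have h2 := hD.comp y (hasFDerivAt_snd (𝕜 := ℂ) (p := y))
  refine ⟨_, (h1.sub_const β).prodMk (h2.sub hasFDerivAt_fst), fun z => ?_⟩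
  rw [← hDs]
  rfl

theorem surjective_fderiv_gcdMap {r : PolyLE k} (β : ℂ) (x : PolyLE m × PolyLE n)
    {t : GCDTriple m n k} (hr : polyDot r t.1 ≠ 0) :
    Function.Surjective (fderiv ℂ (gcdMap hm hn r β) (x, t)) := by
  obtain ⟨D, hD, hDs⟩ := exists_hasFDerivAt_gcdMap (hm := hm) (hn := hn) r β (x, t)
  rw [hD.fderiv]
  rintro ⟨c, y⟩
  -- A multiple of `t.1` attains the scalar component; the data enter through `-(p, q)`, so their
  -- direction can correct the other two.
  let u : PolyLE k := (c / polyDot r t.1) • t.1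
  refine ⟨((mulLE hm t.1 0 + mulLE hm u t.2.1, mulLE hn t.1 0 + mulLE hn u t.2.2) - y, u, 0, 0), ?_⟩
  rw [hDs]
  refine Prod.ext ?_ (sub_sub_cancel _ _)
  exact (polyDot_smul _ _ _).trans (div_mul_cancel₀ _ hr)

theorem injective_fderiv_gcdMap {r : PolyLE k} (β : ℂ) (x : PolyLE m × PolyLE n)
    {t : GCDTriple m n k} (ht : t ∈ regularTriples m n k) (hr : polyDot r t.1 ≠ 0) :
    Function.Injective (fderiv ℂ (fun s => gcdMap hm hn r β (x, s)) t) := by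
  obtain ⟨D, hD, hDs⟩ := exists_hasFDerivAt_gcdMap (hm := hm) (hn := hn) r β (x, t)
  have h : HasFDerivAt (fun s => gcdMap hm hn r β (x, s)) _ t :=
    hD.comp t (hasFDerivAt_prodMk_right x t)
  rw [h.fderiv]
  refine (injective_iff_map_eq_zero _).2 fun s hs => ?_
  rw [ContinuousLinearMap.comp_apply, hDs, Prod.mk_eq_zero] at hs
  have h2 := hs.2
  simp only [ContinuousLinearMap.inr_apply, sub_zero, Prod.mk_eq_zero] at h2
  exact eq_zero_of_deriv_gcdProd_eq_zero ht.1.1 (isCoprime_of_mem_regularTriples ht) hr hs.1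
    h2.1 h2.2

/-- The domain of the geometric model. -/
def gcdDomain (m n k : ℕ) : Set ((PolyLE m × PolyLE n) × GCDTriple m n k) :=
  ({p : PolyLE m | (p : ℂ[X]).degree = m} ×ˢ {q : PolyLE n | (q : ℂ[X]).degree = n}) ×ˢ
    regularTriples m n k

theorem IsGCDTriple.isGeometricModelAt {x : PolyLE m × PolyLE n} {t : GCDTriple m n k}
    (hx : x ∈ gcdManifold m n k) (ht : IsGCDTriple hm hn x t) {r : PolyLE k}
    (hr : polyDot r t.1 ≠ 0) :
    IsGeometricModelAt (gcdManifold m n k) (gcdDomain m n k)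
      (gcdMap hm hn r (polyDot r t.1)) x t where
  finite_data := inferInstance
  finite_var := inferInstance
  finite_target := inferInstance
  dim_var_le := by
    simp only [Module.finrank_prod, PolyLE.finrank_eq, Module.finrank_self]
    omega
  dim_target_le := by
    simp only [Module.finrank_prod, PolyLE.finrank_eq, Module.finrank_self]
    omega
  isOpen_domain :=
    ((PolyLE.isOpen_degree_eq m).prod (PolyLE.isOpen_degree_eq n)).prod isOpen_regularTriples
  mem_domain := ⟨⟨hx.1, hx.2.1⟩, ht.mem_regularTriples hx⟩
  holomorphic := fun y _ => analyticAt_gcdMap r _ y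
  zero_at := gcdMap_eq_zero_iff.2 ⟨rfl, (isGCDTriple_iff.1 ht).2⟩
  jacobian_surjective := surjective_fderiv_gcdMap _ x hr
  partial_jacobian_injective := injective_fderiv_gcdMap _ x (ht.mem_regularTriples hx) hr
  data_mem := fun y s hys h0 => by
    rw [← (gcdMap_eq_zero_iff.1 h0).2]
    exact gcdProd_mem_of_mem_regularTriples hys.2
  unique_solution := fun D hD htD => by
    -- Intersecting `D` with the regular triples places the solution in the domain. Uniqueness then
    -- holds among all normalized factorizations, wherever they lie.
    obtain ⟨S, hS, hxS, hSM⟩ := ht.exists_isOpen_forall_exists hx hr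
      (hD.inter isOpen_regularTriples) ⟨htD, ht.mem_regularTriples hx⟩
    refine ⟨S, hS, hxS, fun y hy => ?_⟩
    obtain ⟨s, hs, hsy, hsr⟩ := hSM y hy
    refine ⟨s, ⟨hs.1, ⟨⟨hy.2.1, hy.2.2.1⟩, hs.2⟩, gcdMap_eq_zero_iff.2 ⟨hsr, hsy⟩⟩, ?_⟩
    rintro s' ⟨-, -, hs'⟩
    rw [gcdMap_eq_zero_iff] at hs'
    have hsgcd : IsGCDTriple hm hn y s := by
      refine isGCDTriple_iff.2 ⟨?_, hsy⟩
      rw [← hsy]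
      exact mem_gcdClass_of_isCoprime (isCoprime_of_mem_regularTriples hs.2)
    exact hsgcd.eq_of_polyDot_eq hy.2 hs'.2 (hsr ▸ hr) (hs'.1.trans hsr.symm)

end

theorem mainTheorem6 (m n k : ℕ) (hm : k ≤ m) (hn : k ≤ n) :
    IsComplexManifoldOfCodim (gcdManifold m n k) k ∧
    Module.finrank ℂ (ℂ × PolyLE m × PolyLE n) = Module.finrank ℂ (GCDTriple m n k) + k ∧
    ∀ x ∈ gcdManifold m n k,
      (∃ t : GCDTriple m n k, IsGCDTriple hm hn x t) ∧
      ∀ t : GCDTriple m n k, IsGCDTriple hm hn x t →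
        (∀ᵐ c : EuclideanSpace ℂ (Fin (k + 1)) ∂volume,
          polyDot ((coeffEquiv k).symm c) t.1 ≠ 0) ∧
        ∀ (r : PolyLE k) (β : ℂ), polyDot r t.1 = β → β ≠ 0 →
          ∃ Ω : Set ((PolyLE m × PolyLE n) × GCDTriple m n k),
            (∀ y ∈ Ω, (y.1.1 : ℂ[X]).degree = m ∧ (y.1.2 : ℂ[X]).degree = n ∧
              (y.2.1 : ℂ[X]).degree = k ∧
              IsCoprime (y.2.2.1 : ℂ[X]) (y.2.2.2 : ℂ[X])) ∧
            IsGeometricModelAt (gcdManifold m n k) Ω (gcdMap hm hn r β) x t := by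
  refine ⟨isComplexManifoldOfCodim_gcdManifold hm hn, ?_, fun x hx =>
    ⟨exists_isGCDTriple hx, fun t ht =>
      ⟨ae_polyDot_ne_zero (ne_zero_of_degree_eq (ht.mem_regularTriples hx).1.1), ?_⟩⟩⟩
  · rw [finrank_gcdTriple, Module.finrank_prod, Module.finrank_prod, PolyLE.finrank_eq,
      PolyLE.finrank_eq, Module.finrank_self]
    omega
  · rintro r β rfl hr
    exact ⟨gcdDomain m n k, fun y hy => ⟨hy.1.1, hy.1.2, hy.2.1.1,
      isCoprime_of_mem_regularTriples hy.2⟩, ht.isGeometricModelAt hx hr⟩
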